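/- Let $d$ be a positive integer. For a linear map $\Phi\colon\mathbb{C}^{d\times d}\to\mathbb{C}^{m\times m}$, let the entanglement breaking rank $\operatorname{ebr}(\Phi)$ denote the smallest $n$ for which there exist matrices $R_1,\dots,R_n\in\mathbb{C}^{m\times d}$, each of rank $1$, such that $\sum_{k=1}^n R_k^*R_k=I_d$ and $\Phi(X)=\sum_{k=1}^n R_kXR_k^*$ for every $X\in\mathbb{C}^{d\times d}$ (with $\operatorname{ebr}(\Phi)=\infty$ if there are no such matrices for any $n$). Let $\mathfrak{Z}_d\colon\mathbb{C}^{d\times d}\to\mathbb{C}^{d\times d}$ be the quantum depolarizing channel $$\mathfrak{Z}_d(X)=\frac{1}{d+1}\bigl(X+\operatorname{tr}(X)\, I_d\bigr).$$ Here a prime power is a number $p^j$ with $p$ prime and $j\ge 1$. Then: (a) $\operatorname{ebr}(\mathfrak{Z}_d)\leq kd^2+2d$ whenever $k$ is a positive integer such that $kd+1$ is a prime power. (b) $\operatorname{ebr}(\mathfrak{Z}_d)\leq d^2+(p+1)d$ whenever $d+1=p^k$ with $p$ prime and $k$ a positive integer. (c) $\operatorname{ebr}(\mathfrak{Z}_d)\leq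 d^2+1$ whenever $d-1$ is a prime power. (d) $\operatorname{ebr}(\mathfrak{Z}_d)\leq d^2+d-1$ whenever $d$ is a prime power. -/

import Mathlib

open scoped Matrix

/-- The family `R` of `n` matrices in `ℂ^{m×d}` is an entanglement breaking decomposition of the
linear map `Φ : ℂ^{d×d} → ℂ^{m×m}`. -/
structure IsEBDecomposition {d m n : ℕ}
    (Φ : Matrix (Fin d) (Fin d) ℂ →ₗ[ℂ] Matrix (Fin m) (Fin m) ℂ)
    (R : Fin n → Matrix (Fin m) (Fin d) ℂ) : Prop where
  map_eq : ∀ X : Matrix (Fin d) (Fin d) ℂ, Φ X = ∑ k, R k * X * (R k)ᴴ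
  sum_eq_one : ∑ k, (R k)ᴴ * R k = 1
  rank_eq_one : ∀ k, (R k).rank = 1

/-- The entanglement breaking rank of `Φ`: the least `n` for which `Φ` has an entanglement breaking
decomposition with `n` terms. It is `⊤` if `Φ` has no such decomposition, so a finite upper bound
on it contains the claim that `Φ` is entanglement breaking. -/
noncomputable def entanglementBreakingRank {d m : ℕ}
    (Φ : Matrix (Fin d) (Fin d) ℂ →ₗ[ℂ] Matrix (Fin m) (Fin m) ℂ) : ℕ∞ :=
  sInf {N : ℕ∞ | ∃ n : ℕ, N = (n : ℕ∞) ∧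
    ∃ R : Fin n → Matrix (Fin m) (Fin d) ℂ, IsEBDecomposition Φ R}

/-- The quantum depolarizing channel `X ↦ (X + tr X · I) / (d + 1)` on `ℂ^{d×d}`. -/
noncomputable def depolarizingChannel (d : ℕ) :
    Matrix (Fin d) (Fin d) ℂ →ₗ[ℂ] Matrix (Fin d) (Fin d) ℂ :=
  (1 / ((d : ℂ) + 1)) •
    (LinearMap.id + (Matrix.traceLinearMap (Fin d) ℂ ℂ).smulRight (1 : Matrix (Fin d) (Fin d) ℂ))

theorem depolarizingChannel_apply (d : ℕ) (X : Matrix (Fin d) (Fin d) ℂ) :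
    depolarizingChannel d X = (1 / ((d : ℂ) + 1)) • (X + X.trace • 1) := by
  simp [depolarizingChannel]

/-! Weighted rank-one projections `√w • v v*` decompose the channel exactly when the weighted sum of
`(v v*) ⊗ (v v*)` is `(1 + swap)/(d + 1)` up to index order. Averaging the vectors `(ψ (g i))_i`
over the characters `ψ` of a finite abelian group detects `g a + g c = g b + g k`; for a Sidon
family this is the required pattern, except that the full diagonal is counted once instead of twice.
The standard basis supplies the missing copy, so the rank is at most `|G| + d`. Bose, Singer and
graph-type Sidon sets give (d), (c) and (a); (b) is weaker than (a) at `k = 1`. -/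

/-- A family is Sidon if its pairwise products determine the unordered pair of indices. -/
def IsSidonFamily {ι G : Type*} [Mul G] (f : ι → G) : Prop :=
  ∀ i j k l, f i * f j = f k * f l → (i = k ∧ j = l) ∨ (i = l ∧ j = k)

/-- An entanglement breaking decomposition indexed by any finite type bounds the rank. -/
theorem entanglementBreakingRank_le_card {d m : ℕ} {κ : Type*} [Fintype κ]
    (Φ : Matrix (Fin d) (Fin d) ℂ →ₗ[ℂ] Matrix (Fin m) (Fin m) ℂ)
    (R : κ → Matrix (Fin m) (Fin d) ℂ)
    (hmap : ∀ X, Φ X = ∑ k, R k * X * (R k)ᴴ) (hone : ∑ k, (R k)ᴴ * R k = 1)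
    (hrank : ∀ k, (R k).rank = 1) :
    entanglementBreakingRank Φ ≤ (Fintype.card κ : ℕ∞) := by
  refine sInf_le ⟨Fintype.card κ, rfl, R ∘ (Fintype.equivFin κ).symm, ⟨fun X => ?_, ?_, ?_⟩⟩
  · rw [hmap X]
    exact ((Fintype.equivFin κ).symm.sum_comp fun k => R k * X * (R k)ᴴ).symm
  · rw [← hone]
    exact (Fintype.equivFin κ).symm.sum_comp fun k => (R k)ᴴ * R k
  · exact fun k => hrank _

theorem rank_vecMulVec_eq_one {m n : Type*} [Fintype m] [Fintype n] {v : m → ℂ} {w : n → ℂ}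
    (hv : v ≠ 0) (hw : w ≠ 0) : (Matrix.vecMulVec v w).rank = 1 := by
  refine le_antisymm (Matrix.rank_vecMulVec_le v w) ?_
  rw [Nat.one_le_iff_ne_zero, Ne, Matrix.rank, Submodule.finrank_eq_zero,
    LinearMap.range_eq_bot]
  obtain ⟨i, hi⟩ := Function.ne_iff.1 hv
  obtain ⟨j, hj⟩ := Function.ne_iff.1 hw
  classical
  intro h
  have hij := congrFun (LinearMap.congr_fun h (Pi.single j 1)) i
  rw [Matrix.mulVecLin_apply, Matrix.mulVec_single_one] at hij
  exact mul_ne_zero hi hj hij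

/-- A weighted complex projective 2-design bounds the entanglement breaking rank of the
depolarizing channel. -/
theorem entanglementBreakingRank_le_of_design {d : ℕ} {κ : Type*} [Fintype κ]
    (w : κ → ℝ) (hw : ∀ k, 0 < w k) (v : κ → Fin d → ℂ) (hv : ∀ k, v k ≠ 0)
    (h : ∀ a b c e, ∑ k, (w k : ℂ) * (v k a * star (v k b) * (v k c * star (v k e))) =
      1 / ((d : ℂ) + 1) * ((if a = b ∧ c = e then 1 else 0) + if a = e ∧ b = c then 1 else 0)) :
    entanglementBreakingRank (depolarizingChannel d) ≤ (Fintype.card κ : ℕ∞) := by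
  set R : κ → Matrix (Fin d) (Fin d) ℂ := fun k =>
    ((√(w k) : ℝ) : ℂ) • Matrix.vecMulVec (v k) (star (v k)) with hR
  have hRH : ∀ k, (R k)ᴴ = R k := by
    intro k
    ext i j
    simp [hR, Matrix.vecMulVec_apply, mul_comm]
  have hsq : ∀ k, ((√(w k) : ℝ) : ℂ) * ((√(w k) : ℝ) : ℂ) = (w k : ℂ) := fun k => by
    rw [← Complex.ofReal_mul, Real.mul_self_sqrt (hw k).le]
  have hmap : ∀ X, depolarizingChannel d X = ∑ k, R k * X * (R k)ᴴ := by
    intro X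
    ext a e
    have hterm : ∀ k, (R k * X * (R k)ᴴ) a e = ∑ b, ∑ c,
        (w k : ℂ) * (v k a * star (v k b) * (v k c * star (v k e))) * X b c := by
      intro k
      rw [hRH, Matrix.mul_apply, Finset.sum_comm]
      refine Finset.sum_congr rfl fun c _ => ?_
      rw [Matrix.mul_apply, Finset.sum_mul]
      refine Finset.sum_congr rfl fun b _ => ?_
      rw [← hsq]
      simp only [hR, Matrix.smul_apply, Matrix.vecMulVec_apply, smul_eq_mul, Pi.star_apply]
      ring
    rw [Matrix.sum_apply, Finset.sum_congr rfl fun k _ => hterm k, Finset.sum_comm]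
    simp_rw [Finset.sum_comm (s := (Finset.univ : Finset κ)), ← Finset.sum_mul, h]
    rw [depolarizingChannel_apply]
    simp only [Matrix.smul_apply, Matrix.add_apply, smul_eq_mul, Matrix.trace, Matrix.diag_apply,
      Matrix.one_apply, ite_and, mul_add, add_mul, Finset.sum_add_distrib]
    simp [mul_ite, ite_mul, Finset.sum_ite_eq, Finset.mul_sum]
  refine entanglementBreakingRank_le_card _ R hmap ?_ fun k => ?_
  -- The `R k` are Hermitian, so the trace condition is the unitality of the channel.
  · have h1 := hmap 1
    have hd : (d : ℂ) + 1 ≠ 0 := by exact_mod_cast d.succ_ne_zero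
    simp only [mul_one, hRH] at h1 ⊢
    rw [← h1, depolarizingChannel_apply, Matrix.trace_one, Fintype.card_fin]
    ext i j
    simp only [Matrix.smul_apply, Matrix.add_apply, smul_eq_mul]
    field_simp
    ring
  · have hs : ((√(w k) : ℝ) : ℂ) ≠ 0 := by
      exact_mod_cast (Real.sqrt_pos.2 (hw k)).ne'
    have : R k = Matrix.vecMulVec (((√(w k) : ℝ) : ℂ) • v k) (star (v k)) := by
      ext i j
      simp [hR, Matrix.vecMulVec_apply, mul_assoc]
    rw [this]
    exact rank_vecMulVec_eq_one (smul_ne_zero hs (hv k)) (star_ne_zero.2 (hv k))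

/-- The characters of a finite abelian group restricted to a Sidon family, together with the
standard basis, form a weighted projective 2-design. -/
theorem entanglementBreakingRank_le_of_sidon {d : ℕ} {G ι : Type*} [CommGroup G] [Finite G]
    {f : ι → G} (hf : IsSidonFamily f) (hι : Nat.card ι = d) (hd : 0 < d) :
    entanglementBreakingRank (depolarizingChannel d) ≤ ((Nat.card G + d : ℕ) : ℕ∞) := by
  classical
  have := Fintype.ofFinite G
  have : Finite ι := Nat.finite_of_card_ne_zero (by omega)
  let e : Fin d ≃ ι := (Finite.equivFinOfCardEq hι).symm
  let g : Fin d → Additive G := fun i => Additive.ofMul (f (e i))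
  have hg : ∀ i j k l, g i + g j = g k + g l ↔ (i = k ∧ j = l) ∨ (i = l ∧ j = k) := by
    intro i j k l
    constructor
    · intro h
      simpa using hf (e i) (e j) (e k) (e l) (Additive.ofMul.injective h)
    · rintro (⟨rfl, rfl⟩ | ⟨rfl, rfl⟩)
      · rfl
      · exact add_comm _ _
  let v : AddChar (Additive G) ℂ ⊕ Fin d → Fin d → ℂ :=
    Sum.elim (fun ψ i => ψ (g i)) (fun i => Pi.single i 1)
  let w : AddChar (Additive G) ℂ ⊕ Fin d → ℝ :=
    Sum.elim (fun _ => 1 / (d + 1) / Nat.card G) (fun _ => 1 / (d + 1))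
  have hG : (0 : ℝ) < Nat.card G := by exact_mod_cast Nat.card_pos
  have hGC : (Fintype.card G : ℂ) ≠ 0 := by exact_mod_cast Fintype.card_ne_zero
  have key := entanglementBreakingRank_le_of_design w (by rintro (_ | _) <;> simp [w] <;> positivity)
    v ?_ ?_
  · rwa [Fintype.card_sum, AddChar.card_eq, Fintype.card_fin, Fintype.card_additive,
      ← Nat.card_eq_fintype_card] at key
  · rintro (ψ | i) h
    · exact (ψ.val_isUnit _).ne_zero (congrFun h ⟨0, hd⟩)
    · simpa [v] using congrFun h i
  · intro a b c k
    have hchar : ∀ ψ : AddChar (Additive G) ℂ,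
        ψ (g a) * star (ψ (g b)) * (ψ (g c) * star (ψ (g k))) =
          ψ (g a + g c - (g b + g k)) := by
      intro ψ
      rw [sub_eq_add_neg, neg_add]
      simp only [AddChar.map_add_eq_mul, AddChar.map_neg_eq_conj]
      simp only [starRingEnd_apply]
      ring
    have hbasis : ∑ i : Fin d, (Pi.single i (1 : ℂ) : Fin d → ℂ) a *
        star ((Pi.single i (1 : ℂ) : Fin d → ℂ) b) *
        ((Pi.single i (1 : ℂ) : Fin d → ℂ) c * star ((Pi.single i (1 : ℂ) : Fin d → ℂ) k)) =
        if a = b ∧ a = c ∧ a = k then 1 else 0 := by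
      rw [Finset.sum_eq_single a]
      · by_cases hab : a = b <;> by_cases hac : a = c <;> by_cases hak : a = k <;>
          simp [hab, hac, hak, Pi.single_apply, eq_comm] <;> grind
      · intro i _ hi
        simp [Pi.single_apply, hi.symm]
      · simp
    simp only [Fintype.sum_sum_type, v, w, Sum.elim_inl, Sum.elim_inr, ← Finset.mul_sum, hbasis,
      hchar, AddChar.sum_apply_eq_ite, sub_eq_zero, hg, Fintype.card_additive,
      Nat.card_eq_fintype_card]
    push_cast
    -- The two alternatives overlap exactly when all four indices agree; the basis vectors restore
    -- the second count.
    have hcase : ((if (a = b ∧ c = k) ∨ a = k ∧ c = b then (1 : ℂ) else 0) +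
        if a = b ∧ a = c ∧ a = k then 1 else 0) =
        (if a = b ∧ c = k then 1 else 0) + if a = k ∧ b = c then 1 else 0 := by
      split_ifs <;> grind
    rw [← hcase, mul_add]
    congr 1
    split_ifs
    · field_simp
    · simp

/-! ### Sidon families from finite fields -/

theorem exists_field_card {q : ℕ} (hq : IsPrimePow q) :
    ∃ (F : Type) (_ : Field F) (_ : Finite F), Nat.card F = q := by
  obtain ⟨p, n, hp, hn, rfl⟩ := hq
  have : Fact p.Prime := ⟨hp.nat_prime⟩
  exact ⟨GaloisField p n, inferInstance, inferInstance, GaloisField.card p n hn.ne'⟩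

/-- Over a finite field there is an extension of each degree, with a primitive element. -/
theorem exists_extension (F : Type) [Field F] [Finite F] (n : ℕ) (hn : 0 < n) :
    ∃ (K : Type) (_ : Field K) (_ : Finite K) (_ : Algebra F K) (θ : K),
      Nat.card K = Nat.card F ^ n ∧
      ∀ P : Polynomial F, P.natDegree < n → Polynomial.aeval θ P = 0 → P = 0 := by
  obtain ⟨p, _⟩ := CharP.exists F
  have hp : Fact p.Prime := ⟨CharP.char_is_prime F p⟩
  have : NeZero n := ⟨hn.ne'⟩
  obtain ⟨θ, hθ⟩ := Field.exists_primitive_element F (FiniteField.Extension F p n)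
  refine ⟨FiniteField.Extension F p n, inferInstance, inferInstance, inferInstance, θ,
    FiniteField.natCard_extension F p n, fun P hP h0 => ?_⟩
  rw [Field.primitive_element_iff_minpoly_natDegree_eq, FiniteField.finrank_extension] at hθ
  by_contra hne
  have := Polynomial.natDegree_le_natDegree (minpoly.degree_le_of_ne_zero F θ hne h0)
  omega

open Polynomial in
/-- The Bose construction. -/
theorem exists_sidon_bose {q : ℕ} (hq : IsPrimePow q) :
    ∃ (G : Type) (_ : CommGroup G) (_ : Finite G) (ι : Type) (f : ι → G),
      IsSidonFamily f ∧ Nat.card ι = q ∧ Nat.card G = q ^ 2 - 1 := by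
  obtain ⟨F, _, _, rfl⟩ := exists_field_card hq
  obtain ⟨K, _, _, _, θ, hK, hθ⟩ := exists_extension F 2 two_pos
  have hne : ∀ a : F, θ + algebraMap F K a ≠ 0 := fun a h =>
    X_add_C_ne_zero a (hθ (X + C a) (by simp) (by simpa using h))
  refine ⟨Kˣ, inferInstance, inferInstance, F, fun a => Units.mk0 _ (hne a), ?_, rfl, ?_⟩
  · intro a b c e h
    replace h := congrArg Units.val h
    simp only [Units.val_mul, Units.val_mk0] at h
    -- The `θ ^ 2` terms cancel, leaving a relation of degree at most 1, so the pairs share sum and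
    -- product.
    have h0 := hθ (C (a + b - c - e) * X + C (a * b - c * e)) (by compute_degree!) (by
      simp only [map_add, map_mul, map_sub, aeval_X, aeval_C]
      linear_combination h)
    have h1 : a + b - c - e = 0 := by simpa using congrArg (coeff · 1) h0
    have h2 : a * b - c * e = 0 := by simpa using congrArg (coeff · 0) h0
    have h3 : (a - c) * (a - e) = 0 := by linear_combination a * h1 - h2
    rcases mul_eq_zero.1 h3 with h | h
    · exact Or.inl ⟨sub_eq_zero.1 h, by linear_combination h1 - h⟩
    · exact Or.inr ⟨sub_eq_zero.1 h, by linear_combination h1 - h⟩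
  · rw [Nat.card_units, hK]

open Polynomial in
/-- The Singer construction. -/
theorem exists_sidon_singer {q : ℕ} (hq : IsPrimePow q) :
    ∃ (G : Type) (_ : CommGroup G) (_ : Finite G) (ι : Type) (f : ι → G),
      IsSidonFamily f ∧ Nat.card ι = q + 1 ∧ Nat.card G = q ^ 2 + q + 1 := by
  obtain ⟨F, _, _, rfl⟩ := exists_field_card hq
  obtain ⟨K, _, _, _, θ, hK, hθ⟩ := exists_extension F 3 three_pos
  -- The `q + 1` points of the projective line, with `none` at infinity, as monic representatives.
  let P : Option F → F[X] := fun o => o.elim 1 fun a => X + C a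
  have hPm : ∀ o, (P o).Monic := by
    rintro (_ | a)
    · exact monic_one
    · exact monic_X_add_C a
  have hPd : ∀ o, (P o).natDegree ≤ 1 := by
    rintro (_ | a) <;> simp [P]
  have hPr : ∀ o, (P o).roots = o.elim 0 fun a => {-a} := by
    rintro (_ | a) <;> simp [P]
  have hne : ∀ o, aeval θ (P o) ≠ 0 := fun o h =>
    (hPm o).ne_zero (hθ _ ((hPd o).trans_lt (by norm_num)) h)
  let φ : Fˣ →* Kˣ := Units.map (algebraMap F K : F →* K)
  have hφ : Function.Injective φ := Units.map_injective (algebraMap F K).injective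
  refine ⟨Kˣ ⧸ φ.range, inferInstance, inferInstance, Option F,
    fun o => QuotientGroup.mk (Units.mk0 _ (hne o)), ?_, Finite.card_option, ?_⟩
  · intro i j k l h
    rw [← QuotientGroup.mk_mul, ← QuotientGroup.mk_mul, QuotientGroup.eq] at h
    obtain ⟨u, hu⟩ := h
    have hu' := congrArg Units.val (eq_inv_mul_iff_mul_eq.1 hu)
    simp only [Units.val_mul, Units.val_mk0, φ, Units.coe_map, MonoidHom.coe_coe] at hu'
    have hdeg : ∀ o o', (P o * P o').natDegree ≤ 2 := fun o o' =>
      natDegree_mul_le.trans (add_le_add (hPd o) (hPd o'))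
    have h0 := hθ (P i * P j * C (u : F) - P k * P l)
      ((natDegree_sub_le _ _).trans_lt (by
        have h1 := (natDegree_mul_C_le (P i * P j) (u : F)).trans (hdeg i j)
        have h2 := hdeg k l
        omega)) (by simpa [sub_eq_zero] using hu')
    rw [sub_eq_zero] at h0
    -- Monicity removes the scalar ambiguity of the quotient; the roots then recover the pair.
    have hu1 : (u : F) = 1 := by
      have := congrArg leadingCoeff h0
      rwa [leadingCoeff_mul, leadingCoeff_C, ((hPm i).mul (hPm j)).leadingCoeff,
        ((hPm k).mul (hPm l)).leadingCoeff, one_mul] at this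
    rw [hu1, C_1, mul_one] at h0
    have hr := congrArg roots h0
    rw [roots_mul ((hPm i).mul (hPm j)).ne_zero, roots_mul ((hPm k).mul (hPm l)).ne_zero,
      hPr, hPr, hPr, hPr] at hr
    have hc := congrArg Multiset.card hr
    rcases i with _ | a <;> rcases j with _ | b <;> rcases k with _ | c <;> rcases l with _ | e <;>
      simp at hc <;> simp at hr <;> simp [hr]
    rcases Multiset.cons_eq_cons.1 hr with ⟨h1, h2⟩ | ⟨-, s, h1, h2⟩
    · exact Or.inl ⟨neg_injective h1, neg_injective (Multiset.singleton_inj.1 h2)⟩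
    · have hs : s = 0 := by simpa using congrArg Multiset.card h1
      subst hs
      exact Or.inr ⟨(neg_injective (Multiset.singleton_inj.1 h2)).symm,
        neg_injective (Multiset.singleton_inj.1 h1)⟩
  · have h1 := Subgroup.card_eq_card_quotient_mul_card_subgroup φ.range
    rw [Nat.card_congr (MonoidHom.ofInjective hφ).toEquiv.symm, Nat.card_units, Nat.card_units,
      hK] at h1
    have hF : 2 ≤ Nat.card F := Finite.one_lt_card
    obtain ⟨r, hr⟩ : ∃ r, Nat.card F = r + 1 := ⟨Nat.card F - 1, by omega⟩
    rw [hr] at h1 ⊢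
    have hr0 : 0 < r := by omega
    refine Nat.eq_of_mul_eq_mul_right hr0 ?_
    rw [Nat.add_sub_cancel] at h1
    rw [← h1]
    refine Nat.sub_eq_of_eq_add ?_
    ring

/-- The subgroup of order `d` of the multiplicative group of a field with `k * d + 1` elements
is a Sidon set in the product with the additive group. -/
theorem exists_sidon_graph {d k : ℕ} (hq : IsPrimePow (k * d + 1)) :
    ∃ (G : Type) (_ : CommGroup G) (_ : Finite G) (ι : Type) (f : ι → G),
      IsSidonFamily f ∧ Nat.card ι = d ∧ Nat.card G = d * (k * d + 1) := by
  obtain ⟨F, _, _, hF⟩ := exists_field_card hq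
  have hkd : k * d ≠ 0 := fun h => by simp [h, not_isPrimePow_one] at hq
  -- The `k`-th powers in a cyclic group of order `k * d`.
  let H : Subgroup Fˣ := (powMonoidHom k : Fˣ →* Fˣ).range
  have hH : Nat.card H = d := by
    rw [IsCyclic.card_powMonoidHom_range, Nat.card_units, hF, Nat.add_sub_cancel,
      Nat.gcd_mul_right_left, Nat.mul_div_cancel_left _ (Nat.pos_of_ne_zero (left_ne_zero_of_mul hkd))]
  refine ⟨H × Multiplicative F, inferInstance, inferInstance, H,
    fun x => (x, Multiplicative.ofAdd ((x : Fˣ) : F)), ?_, hH, ?_⟩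
  · intro a b c e h
    obtain ⟨h1, h2⟩ := Prod.ext_iff.1 h
    replace h1 : ((a : Fˣ) : F) * ((b : Fˣ) : F) = ((c : Fˣ) : F) * ((e : Fˣ) : F) :=
      congrArg (fun x : H => ((x : Fˣ) : F)) h1
    replace h2 : ((a : Fˣ) : F) + ((b : Fˣ) : F) = ((c : Fˣ) : F) + ((e : Fˣ) : F) := h2
    have hext : ∀ x y : H, ((x : Fˣ) : F) = ((y : Fˣ) : F) → x = y := fun x y h =>
      Subtype.ext (Units.ext h)
    -- Equal sum and product: `a` is a root of `(X - c)(X - e)`.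
    have h3 : (((a : Fˣ) : F) - ((c : Fˣ) : F)) * (((a : Fˣ) : F) - ((e : Fˣ) : F)) = 0 := by
      linear_combination ((a : Fˣ) : F) * h2 - h1
    rcases mul_eq_zero.1 h3 with h | h
    · exact Or.inl ⟨hext _ _ (sub_eq_zero.1 h), hext _ _ (by linear_combination h2 - h)⟩
    · exact Or.inr ⟨hext _ _ (sub_eq_zero.1 h), hext _ _ (by linear_combination h2 - h)⟩
  · rw [Nat.card_prod, hH, Nat.card_congr (Multiplicative.toAdd (α := F)), hF]

theorem corollary2p5 (d : ℕ) :
    (∀ k : ℕ, IsPrimePow (k * d + 1) →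
      entanglementBreakingRank (depolarizingChannel d) ≤ ((k * d ^ 2 + 2 * d : ℕ) : ℕ∞)) ∧
    (∀ p k : ℕ, p.Prime → d + 1 = p ^ k →
      entanglementBreakingRank (depolarizingChannel d) ≤ ((d ^ 2 + (p + 1) * d : ℕ) : ℕ∞)) ∧
    (IsPrimePow (d - 1) →
      entanglementBreakingRank (depolarizingChannel d) ≤ ((d ^ 2 + 1 : ℕ) : ℕ∞)) ∧
    (IsPrimePow d →
      entanglementBreakingRank (depolarizingChannel d) ≤ ((d ^ 2 + d - 1 : ℕ) : ℕ∞)) := by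
  have ha : ∀ k : ℕ, IsPrimePow (k * d + 1) →
      entanglementBreakingRank (depolarizingChannel d) ≤ ((k * d ^ 2 + 2 * d : ℕ) : ℕ∞) := by
    intro k hk
    obtain ⟨G, _, _, ι, f, hf, hι, hG⟩ := exists_sidon_graph hk
    have hd : 0 < d := Nat.pos_of_ne_zero fun h => by simp [h, not_isPrimePow_one] at hk
    convert entanglementBreakingRank_le_of_sidon hf hι hd using 2
    rw [hG]
    ring
  refine ⟨ha, fun p k hp hk => ?_, fun hd => ?_, fun hd => ?_⟩
  -- `k = 0` forces `d = 0`, where the empty decomposition works.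
  · rcases Nat.eq_zero_or_pos k with rfl | hk0
    · obtain rfl : d = 0 := by simpa using hk
      have h := entanglementBreakingRank_le_card (depolarizingChannel 0) (κ := Empty) Empty.elim
        (fun X => Subsingleton.elim _ _) (Subsingleton.elim _ _) (fun k => k.elim)
      exact h.trans (by simp)
    · refine (ha 1 ?_).trans ?_
      · rw [one_mul, hk]
        exact hp.isPrimePow.pow hk0.ne'
      · have := Nat.mul_le_mul_right d hp.one_le
        exact_mod_cast (by linarith : 1 * d ^ 2 + 2 * d ≤ d ^ 2 + (p + 1) * d)
  · obtain ⟨G, _, _, ι, f, hf, hι, hG⟩ := exists_sidon_singer hd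
    have := hd.two_le
    obtain ⟨q, rfl⟩ : ∃ q, d = q + 1 := ⟨d - 1, by omega⟩
    rw [Nat.add_sub_cancel] at hι hG
    convert entanglementBreakingRank_le_of_sidon hf hι q.succ_pos using 2
    rw [hG]
    ring
  · obtain ⟨G, _, _, ι, f, hf, hι, hG⟩ := exists_sidon_bose hd
    convert entanglementBreakingRank_le_of_sidon hf hι hd.pos using 2
    have := Nat.pow_pos (n := 2) hd.pos
    omega
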